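/- Let $R$ be a commutative quasi-local ring, that is, a commutative ring with exactly one maximal ideal $\mathfrak m$ ($R$ is not assumed to be Noetherian). The following statements are equivalent: (a) $R$ is Noetherian. (b) $R$ is co-noetherian, i.e. the injective hull of every simple $R$-module is Artinian. (c) $R$ satisfies condition $(\diamond)$: the injective hull of every simple $R$-module is locally Artinian, i.e. all its finitely generated submodules are Artinian; and the $R$-module $\mathfrak m/\mathfrak m^2$ is finitely generated. (d) $\bigcap_{n=0}^{\infty}(I+\mathfrak m^n)=I$ for every ideal $I$ of $R$, and the $R$-module $\mathfrak m/\mathfrak m^2$ is finitely generated. -/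

import Mathlib

universe u

/-- A submodule `N` of `M` is essential if it meets every nonzero submodule of `M` nontrivially. -/
def IsEssentialSubmodule {R M : Type u} [Ring R] [AddCommGroup M] [Module R M]
    (N : Submodule R M) : Prop :=
  ∀ L : Submodule R M, N ⊓ L = ⊥ → L = ⊥

/-- `i : S → E` exhibits `E` as an injective hull of `S`: the module `E` is injective, and `i` is
an injective map whose image is an essential submodule of `E`. -/
structure IsInjectiveHull {R S E : Type u} [Ring R] [AddCommGroup S] [Module R S]
    [AddCommGroup E] [Module R E] (i : S →ₗ[R] E) : Prop where
  moduleInjective : Module.Injective R E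
  injective : Function.Injective i
  essential : IsEssentialSubmodule (LinearMap.range i)

/-- A module is locally Artinian if all its finitely generated submodules are Artinian. -/
def IsLocallyArtinian (R M : Type u) [Ring R] [AddCommGroup M] [Module R M] : Prop :=
  ∀ N : Submodule R M, N.FG → IsArtinian R N

/-- A ring is (left) co-noetherian if injective hulls of simple (left) modules are Artinian.
Injective hulls exist in the universe of the ring and are unique up to isomorphism. -/
def IsCoNoetherianRing (R : Type u) [Ring R] : Prop :=
  ∀ (S E : Type u) [AddCommGroup S] [Module R S] [AddCommGroup E] [Module R E]
    (i : S →ₗ[R] E), IsSimpleModule R S → IsInjectiveHull i → IsArtinian R E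

/-- Condition (⋄): injective hulls of simple (left) modules are locally Artinian. -/
def SatisfiesDiamond (R : Type u) [Ring R] : Prop :=
  ∀ (S E : Type u) [AddCommGroup S] [Module R S] [AddCommGroup E] [Module R E]
    (i : S →ₗ[R] E), IsSimpleModule R S → IsInjectiveHull i → IsLocallyArtinian R E

/-! Write `E` for the hull of the residue field and gr for the associated graded ring of `m`. If `m`
is finitely generated, gr is a finitely generated algebra over a field, hence Noetherian. Chain
conditions follow from a strictly monotone encoding by homogeneous ideals of gr
(`wellFoundedGT_of_strictMono_family`), which is used twice. (d) ⇒ (a): an ideal is encoded by its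
initial ideal; closedness of ideals makes this strict, and also yields finite generation of `m`. (a)
⇒ (b): a submodule `M` of `E` is encoded, with order reversed, through the annihilators of its
pieces killed by `m ^ n`. Finite-length duality recovers each piece, and `E` is `m`-power torsion.
(b) ⇒ (c): `I ↦ ann_E I` reverses order strictly, so DCC on `E` gives ACC on `R`. (c) ⇒ (d): if `x ∉
I`, some `y` in `E` is killed by `I` but not by `x`; as `R y` is Artinian, a power of `m` kills `y`,
so `x ∉ I + m ^ n`. -/

/-! ### Existence of injective hulls -/

open Submodule in
theorem Submodule.exists_injective_essential {R Q : Type u} [Ring R] [AddCommGroup Q] [Module R Q]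
    [Module.Injective R Q] (N : Submodule R Q) :
    ∃ E : Submodule R Q, N ≤ E ∧ Module.Injective R E ∧ ∀ X ≤ E, N ⊓ X = ⊥ → X = ⊥ := by
  obtain ⟨E, hNE, hE⟩ := zorn_le_nonempty₀
    {L : Submodule R Q | N ≤ L ∧ ∀ X ≤ L, N ⊓ X = ⊥ → X = ⊥} (by
      intro c hc hchain L hL
      refine ⟨sSup c, ⟨(hc hL).1.trans (le_sSup hL), fun X hX hNX ↦ ?_⟩, fun z hz ↦ le_sSup hz⟩
      rw [eq_bot_iff]
      intro x hx
      obtain ⟨K, hK, hxK⟩ := (mem_sSup_of_directed ⟨L, hL⟩ hchain.directedOn).1 (hX hx)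
      have hxX : R ∙ x ≤ X := by simpa using hx
      have := (hc hK).2 (R ∙ x) (by simpa using hxK)
        (le_bot_iff.1 ((inf_le_inf_left N hxX).trans hNX.le))
      simpa using this)
    N ⟨le_rfl, fun X hX h ↦ by rwa [inf_eq_right.2 hX] at h⟩
  -- Maximality of `C` makes `E → Q ⧸ C` an essential embedding. The inclusion of `E` extends to `g`
  -- on `Q ⧸ C`, whose range is then essential over `N`; maximality of `E` forces the range into
  -- `E`, so `g ∘ C.mkQ` retracts `Q` onto `E`.
  obtain ⟨C, -, hC⟩ := zorn_le_nonempty₀ {C : Submodule R Q | Disjoint E C} (by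
      intro c hc hchain L hL
      exact ⟨sSup c, hchain.directedOn.disjoint_sSup_right.2 fun z hz ↦ hc hz,
        fun z hz ↦ le_sSup hz⟩)
    ⊥ disjoint_bot_right
  have hEC : Disjoint E C := hC.prop
  have hCmax : ∀ Y, C ≤ Y → Disjoint E Y → Y ≤ C := fun Y hY h ↦ hC.le_of_ge h hY
  have hj : Function.Injective (C.mkQ ∘ₗ E.subtype) := by
    rw [← LinearMap.ker_eq_bot, eq_bot_iff]
    intro x hx
    have hx' : (x : Q) ∈ C := by simpa using hx
    simpa using disjoint_def.1 hEC x x.2 hx'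
  obtain ⟨g, hg⟩ := Module.Injective.out (C.mkQ ∘ₗ E.subtype) hj E.subtype
  have hg' : ∀ x ∈ E, g (C.mkQ x) = x := fun x hx ↦ hg ⟨x, hx⟩
  have hrange : LinearMap.range g ≤ E := by
    refine hE.le_of_ge ⟨fun x hx ↦ ⟨_, hg' x (hNE hx)⟩, fun X hX hNX ↦ ?_⟩
      fun x hx ↦ ⟨_, hg' x hx⟩
    have hXE : X ⊓ E = ⊥ := hE.prop.2 _ inf_le_right
      (le_bot_iff.1 ((inf_le_inf_left N inf_le_left).trans hNX.le))
    have hY : (X.comap g).comap C.mkQ ≤ C := by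
      refine hCmax _ (fun c hc ↦ ?_) (disjoint_def.2 fun x hxE hx ↦ ?_)
      · have : C.mkQ c = 0 := by simpa using hc
        simp only [mem_comap, this, zero_mem]
      · simp only [mem_comap, hg' x hxE] at hx
        exact (mem_bot R).1 (hXE ▸ mem_inf.2 ⟨hx, hxE⟩)
    rw [eq_bot_iff]
    intro x hx
    obtain ⟨y, rfl⟩ := hX hx
    obtain ⟨y, rfl⟩ := C.mkQ_surjective y
    have : C.mkQ y = 0 := by simpa using hY hx
    simp [this]
  refine ⟨E, hNE, ⟨fun X Y _ _ _ _ f hf φ ↦ ?_⟩, hE.prop.2⟩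
  obtain ⟨ψ, hψ⟩ := Module.Injective.out f hf (E.subtype ∘ₗ φ)
  refine ⟨(g ∘ₗ C.mkQ).codRestrict E (fun x ↦ hrange ⟨_, rfl⟩) ∘ₗ ψ, fun x ↦ Subtype.ext ?_⟩
  have := hψ x
  simp only [LinearMap.comp_apply, subtype_apply] at this
  simp only [LinearMap.comp_apply, LinearMap.codRestrict_apply, this]
  exact hg' _ (φ x).2

open CategoryTheory in
theorem Module.exists_injective_embedding {R : Type u} [Ring R] (S : Type u) [AddCommGroup S]
    [Module R S] : ∃ (Q : Type u) (_ : AddCommGroup Q) (_ : Module R Q) (f : S →ₗ[R] Q),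
      Module.Injective R Q ∧ Function.Injective f := by
  let p := (EnoughInjectives.presentation (ModuleCat.of R S)).some
  have hp := p.injective
  refine ⟨p.J, inferInstance, inferInstance, p.f.hom, ?_, (ModuleCat.mono_iff_injective _).1 p.mono⟩
  exact Module.injective_module_of_injective_object R p.J (inj := hp)

/-- Conditions (b) and (c) quantify over all hulls, so drawing consequences from them requires that
one exists. -/
theorem exists_isInjectiveHull {R : Type u} [Ring R] (S : Type u) [AddCommGroup S]
    [Module R S] : ∃ (E : Type u) (_ : AddCommGroup E) (_ : Module R E) (i : S →ₗ[R] E),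
      IsInjectiveHull i := by
  obtain ⟨Q, _, _, f, hQ, hf⟩ := Module.exists_injective_embedding (R := R) S
  obtain ⟨E, hE, hinj, hess⟩ := (LinearMap.range f).exists_injective_essential
  refine ⟨E, inferInstance, inferInstance, f.codRestrict E fun x ↦ hE ⟨x, rfl⟩, hinj,
    fun x y h ↦ hf (congrArg Subtype.val h), fun L hL ↦ ?_⟩
  have h := hess (L.map E.subtype) (Submodule.map_subtype_le _ _) (by
    rw [eq_bot_iff]
    rintro _ ⟨⟨s, rfl⟩, ⟨l, hl, hls⟩⟩
    have : l = 0 := (Submodule.mem_bot R).1 (hL ▸ Submodule.mem_inf.2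
      ⟨⟨s, Subtype.ext hls.symm⟩, hl⟩)
    simp [← hls, this])
  exact Submodule.map_injective_of_injective E.injective_subtype (h.trans (Submodule.map_bot _).symm)

/-! ### The associated graded ring and closed ideals -/

section Rees

open Polynomial

variable {R : Type*} [CommRing R] {m : Ideal R}

/-- The ideal `⨁ Fₙ tⁿ` of the Rees algebra, for a family of ideals stable under powers of `m`. -/
def reesAlgebra.idealOfFamily (F : ℕ → Ideal R) (hF : ∀ i j, m ^ i * F j ≤ F (i + j)) :
    Ideal (reesAlgebra m) where
  carrier := {f | ∀ n, (f : R[X]).coeff n ∈ F n}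
  zero_mem' n := by simp
  add_mem' hf hg n := by simpa using add_mem (hf n) (hg n)
  smul_mem' a f hf n := by
    simp only [smul_eq_mul, MulMemClass.coe_mul, coeff_mul]
    refine sum_mem fun p hp ↦ ?_
    rw [← Finset.HasAntidiagonal.mem_antidiagonal.1 hp]
    exact hF _ _ (Ideal.mul_mem_mul (a.2 _) (hf _))

/-- The quotient is the associated graded ring of `m`, a finitely generated algebra over the field
`R ⧸ m`. -/
theorem reesAlgebra.isNoetherianRing_quotient_map [m.IsMaximal] (hm : m.FG) :
    IsNoetherianRing (reesAlgebra m ⧸ m.map (algebraMap R (reesAlgebra m))) := by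
  have h1 : Algebra.FiniteType R (reesAlgebra m) :=
    (Subalgebra.fg_iff_finiteType _).1 (reesAlgebra.fg hm)
  have h2 : Algebra.FiniteType (R ⧸ m) (reesAlgebra m ⧸ m.map (algebraMap R (reesAlgebra m))) :=
    Algebra.FiniteType.of_restrictScalars_finiteType R _ _
  let := Ideal.Quotient.field m
  exact Algebra.FiniteType.isNoetherianRing (R ⧸ m)
    (reesAlgebra m ⧸ m.map (algebraMap R (reesAlgebra m)))

/-- The hypotheses say that the `F a n / m ^ (n + 1)` are the components of a homogeneous ideal of
the associated graded ring. Such an ideal determines its components, so strictness survives and ACC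
is inherited. -/
theorem wellFoundedGT_of_strictMono_family [m.IsMaximal] (hm : m.FG) {α : Type*} [Preorder α]
    (F : α → ℕ → Ideal R) (hF : StrictMono F) (hle : ∀ a n, F a n ≤ m ^ n)
    (hge : ∀ a n, m ^ (n + 1) ≤ F a n) (hmul : ∀ a i j, m ^ i * F a j ≤ F a (i + j)) :
    WellFoundedGT α := by
  have := reesAlgebra.isNoetherianRing_quotient_map hm
  let J := m.map (algebraMap R (reesAlgebra m))
  let G (a : α) : Ideal (reesAlgebra m) := reesAlgebra.idealOfFamily (F a) (hmul a)
  have hJ (a : α) : J ≤ G a := by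
    refine Ideal.map_le_iff_le_comap.2 fun r hr n ↦ ?_
    change (C r).coeff n ∈ F a n
    rw [coeff_C]
    split_ifs with h
    · subst h
      exact hge a 0 (by simpa using hr)
    · exact zero_mem _
  have hG (a b : α) (h : G a ≤ G b) : F a ≤ F b := by
    intro n x hx
    have := h (show (⟨monomial n x, reesAlgebra.monomial_mem.2 (hle a n hx)⟩ : reesAlgebra m) ∈ G a
      from fun k ↦ by
        change (monomial n x).coeff k ∈ F a k
        rw [coeff_monomial]
        split_ifs with h
        · exact h ▸ hx
        · exact zero_mem _) n
    simpa using this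
  have hcomap (a : α) : ((G a).map (Ideal.Quotient.mk J)).comap (Ideal.Quotient.mk J) = G a := by
    rw [Ideal.comap_map_of_surjective' _ Ideal.Quotient.mk_surjective, Ideal.mk_ker,
      sup_eq_left.2 (hJ a)]
  refine StrictMono.wellFoundedGT (f := fun a ↦ (G a).map (Ideal.Quotient.mk J)) fun a b hab ↦ ?_
  refine lt_of_le_not_ge (Ideal.map_mono fun f hf n ↦ (hF hab).le n (hf n)) fun h ↦ ?_
  have := Ideal.comap_mono (f := Ideal.Quotient.mk J) h
  rw [hcomap, hcomap] at this
  exact (hF hab).not_ge (hG _ _ this)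

/-- If `m` is a finitely generated maximal ideal and all ideals are closed in the `m`-adic
topology, then the ring is Noetherian. -/
theorem isNoetherianRing_of_iInf_sup_pow [m.IsMaximal] (hm : m.FG)
    (h : ∀ I : Ideal R, ⨅ n : ℕ, (I ⊔ m ^ n) = I) : IsNoetherianRing R := by
  refine isNoetherian_iff'.2 (wellFoundedGT_of_strictMono_family hm
    (fun I n ↦ I ⊓ m ^ n ⊔ m ^ (n + 1)) (fun I I' hI ↦ ?_)
    (fun I n ↦ sup_le inf_le_right (Ideal.pow_le_pow_right n.le_succ))
    (fun I n ↦ le_sup_right) fun I i j ↦ ?_)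
  · refine lt_of_le_not_ge (fun n ↦ sup_le_sup_right (inf_le_inf_right _ hI.le) _) fun hle ↦ ?_
    -- Successive approximation: if `I ≤ I'` have the same initial ideal, an error term in `I' ⊓ m ^
    -- n` can be corrected by `I` modulo `m ^ (n + 1)`. Thus `I' ≤ I ⊔ m ^ n` for all `n`, and `I`
    -- is closed.
    refine hI.not_ge ((le_iInf fun n ↦ ?_).trans (h I).le)
    induction n with
    | zero => simp
    | succ n ih =>
      intro x hx
      obtain ⟨y, hy, z, hz, rfl⟩ := Submodule.mem_sup.1 (ih hx)
      have hzI : z ∈ I' := by simpa using sub_mem hx (hI.le hy)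
      exact add_mem (Ideal.mem_sup_left hy)
        (sup_le_sup_right (inf_le_left : I ⊓ m ^ n ≤ I) (m ^ (n + 1))
          (hle n (Ideal.mem_sup_left ⟨hzI, hz⟩)))
  · change m ^ i * (I ⊓ m ^ j ⊔ m ^ (j + 1)) ≤ I ⊓ m ^ (i + j) ⊔ m ^ (i + j + 1)
    rw [Ideal.mul_sup, ← pow_add, add_assoc]
    refine sup_le_sup_right (le_inf (Ideal.mul_le_right.trans inf_le_left) ?_) _
    exact (Ideal.mul_mono_right (inf_le_right : I ⊓ m ^ j ≤ m ^ j)).trans (pow_add m i j).ge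

/-- Closedness replaces Nakayama: lifting generators of the cotangent space gives `J` with `m ≤ J ⊔
m ^ 2`, and iteration gives `m ≤ J ⊔ m ^ n` for all `n`. -/
theorem Ideal.fg_of_finite_cotangent (h : ∀ I : Ideal R, ⨅ n : ℕ, (I ⊔ m ^ n) = I)
    [Module.Finite R m.Cotangent] : m.FG := by
  obtain ⟨k, s, hs⟩ := Module.Finite.exists_fin (R := R) (M := m.Cotangent)
  choose t ht using fun i ↦ m.toCotangent_surjective (s i)
  let J := Ideal.span (Set.range fun i ↦ (t i : R))
  have hJm : J ≤ m := Ideal.span_le.2 (by rintro _ ⟨i, rfl⟩; exact (t i).2)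
  have hJ : Submodule.map m.subtype (Submodule.span R (Set.range t)) = J := by
    rw [Submodule.map_span, ← Set.range_comp]; rfl
  have h2 : m ≤ J ⊔ m * m := by
    intro x hx
    have : m.toCotangent ⟨x, hx⟩ ∈ Submodule.map m.toCotangent (Submodule.span R (Set.range t)) := by
      rw [Submodule.map_span, ← Set.range_comp]
      have : (m.toCotangent ∘ t) = s := funext ht
      rw [this, hs]; trivial
    obtain ⟨y, hy, hxy⟩ := this
    rw [m.toCotangent_eq, ← neg_mem_iff, pow_two, neg_sub] at hxy
    have hyJ : (y : R) ∈ J := hJ ▸ Submodule.mem_map_of_mem hy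
    simpa using add_mem (Ideal.mem_sup_left hyJ) (Ideal.mem_sup_right (S := J) hxy)
  have hm : m ≤ J := by
    refine (le_iInf fun n ↦ ?_).trans (h J).le
    induction n with
    | zero => simp
    | succ n ih =>
      refine h2.trans (sup_le le_sup_left ((Ideal.mul_mono_right ih).trans ?_))
      rw [Ideal.mul_sup, pow_succ']
      exact sup_le_sup_right Ideal.mul_le_right _
  rw [hm.antisymm hJm]
  exact Submodule.fg_span (Set.finite_range _)

end Rees

/-! ### Duality with respect to the injective hull -/

section Hull

open IsLocalRing Submodule

variable {R S E : Type u} [CommRing R] [AddCommGroup S] [Module R S] [AddCommGroup E] [Module R E]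
  {i : S →ₗ[R] E}

theorem IsInjectiveHull.exists_smul_eq [IsSimpleModule R S] (h : IsInjectiveHull i) {e : E}
    (he : e ≠ 0) (s : S) : ∃ c : R, c • e = i s := by
  have h1 : LinearMap.range i ⊓ R ∙ e ≠ ⊥ := fun h0 ↦ he (by simpa using h.essential _ h0)
  obtain ⟨x, ⟨⟨t, rfl⟩, hx⟩, hx0⟩ := exists_mem_ne_zero_of_ne_bot h1
  obtain ⟨a, ha⟩ := mem_span_singleton.1 hx
  have ht : t ≠ 0 := fun h0 ↦ hx0 (by simp [h0])
  obtain ⟨b, hb⟩ := mem_span_singleton.1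
    (show s ∈ R ∙ t by rw [IsSimpleModule.span_singleton_eq_top R ht]; trivial)
  exact ⟨b * a, by rw [mul_smul, ha, ← map_smul, hb]⟩

theorem IsLocalRing.smul_eq_zero_of_isSimpleModule [IsLocalRing R] [IsSimpleModule R S] {r : R}
    (hr : r ∈ maximalIdeal R) (s : S) : r • s = 0 := by
  obtain ⟨I, hI, ⟨e⟩⟩ := (isSimpleModule_iff_quot_maximal (R := R) (M := S)).1 inferInstance
  rw [IsLocalRing.eq_maximalIdeal hI] at e
  apply e.injective
  obtain ⟨a, ha⟩ := Ideal.Quotient.mk_surjective (e s)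
  rw [map_smul, map_zero, ← ha, Algebra.smul_def, Ideal.Quotient.algebraMap_eq, ← map_mul]
  exact Ideal.Quotient.eq_zero_iff_mem.2 (Ideal.mul_mem_right _ _ hr)

/-- The injective hull of the simple module over a local ring is a cogenerator. -/
theorem IsInjectiveHull.exists_smul_ne_zero [IsLocalRing R] [IsSimpleModule R S]
    (h : IsInjectiveHull i) {I : Ideal R} {r : R} (hr : r ∉ I) :
    ∃ y : E, (∀ a ∈ I, a • y = 0) ∧ r • y ≠ 0 := by
  have := h.moduleInjective
  have := IsSimpleModule.nontrivial R S
  obtain ⟨s, hs⟩ := exists_ne (0 : S)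
  -- The annihilator of `x ≠ 0` is a proper ideal, so it kills the simple module and `x ↦ i s` is
  -- well defined on `R x`. Injectivity extends this map to `R ⧸ I`; the image of `1` is the
  -- required `y`.
  let x : R ⧸ I := Ideal.Quotient.mk I r
  have hx : x ≠ 0 := fun h0 ↦ hr (Ideal.Quotient.eq_zero_iff_mem.1 h0)
  let f : R →ₗ[R] R ⧸ I := LinearMap.toSpanSingleton R _ x
  let g : R →ₗ[R] E := LinearMap.toSpanSingleton R _ (i s)
  have hle : LinearMap.ker f ≤ LinearMap.ker g := by
    intro a ha
    have ha' : a ∈ maximalIdeal R := by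
      refine (mem_maximalIdeal a).2 fun hu ↦ hx ?_
      exact hu.smul_eq_zero.1 (by simpa [f] using ha)
    have : a • i s = 0 := by rw [← map_smul, smul_eq_zero_of_isSimpleModule ha', map_zero]
    simpa [g] using this
  obtain ⟨φ, hφ⟩ := Module.Injective.out ((LinearMap.ker f).liftQ f le_rfl)
    (LinearMap.ker_eq_bot.1 (Submodule.ker_liftQ_eq_bot _ _ _ le_rfl))
    ((LinearMap.ker f).liftQ g hle)
  refine ⟨φ (Ideal.Quotient.mk I 1), fun a ha ↦ ?_, ?_⟩
  · rw [← map_smul, Algebra.smul_def, Ideal.Quotient.algebraMap_eq, ← map_mul, mul_one,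
      Ideal.Quotient.eq_zero_iff_mem.2 ha, map_zero]
  · have h1 := hφ (Submodule.Quotient.mk 1)
    simp only [liftQ_apply, f, g, LinearMap.toSpanSingleton_apply, one_smul] at h1
    rw [← map_smul, Algebra.smul_def, Ideal.Quotient.algebraMap_eq, ← map_mul, mul_one]
    change φ x ≠ 0
    rw [h1]
    exact fun h0 ↦ hs (h.injective (by simpa using h0))

theorem IsInjectiveHull.annihilator_torsionBySet [IsLocalRing R] [IsSimpleModule R S]
    (h : IsInjectiveHull i) (I : Ideal R) : (torsionBySet R E (I : Set R)).annihilator = I := by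
  refine le_antisymm (fun r hr ↦ ?_) fun r hr ↦ mem_annihilator.2 fun y hy ↦
    (mem_torsionBySet_iff _ _).1 hy ⟨r, hr⟩
  by_contra hrI
  obtain ⟨y, hy, hry⟩ := h.exists_smul_ne_zero hrI
  exact hry (mem_annihilator.1 hr y ((mem_torsionBySet_iff _ _).2 fun a ↦ hy a a.2))

theorem IsInjectiveHull.isNoetherianRing [IsLocalRing R] [IsSimpleModule R S]
    (h : IsInjectiveHull i) [IsArtinian R E] : IsNoetherianRing R := by
  refine isNoetherian_iff'.2 ?_
  have : WellFoundedGT (Submodule R E)ᵒᵈ := inferInstance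
  refine StrictMono.wellFoundedGT
    (f := fun I : Ideal R ↦ OrderDual.toDual (torsionBySet R E (I : Set R))) fun I J hIJ ↦ ?_
  refine lt_of_le_not_ge (torsionBySet_le_torsionBySet_of_subset hIJ.le) fun hle ↦ hIJ.not_ge ?_
  have := annihilator_mono (R := R) (M := E) (OrderDual.toDual_le_toDual.1 hle)
  rwa [h.annihilator_torsionBySet, h.annihilator_torsionBySet] at this

/-- If all ideals are closed in the `m`-adic topology, the injective hull of the residue field is
`m`-power torsion. -/
theorem IsInjectiveHull.exists_pow_smul_eq_zero [IsSimpleModule R S] (h : IsInjectiveHull i)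
    {m : Ideal R} (hm : ∀ I : Ideal R, ⨅ n : ℕ, (I ⊔ m ^ n) = I) (x : E) :
    ∃ n : ℕ, ∀ a ∈ m ^ n, a • x = 0 := by
  by_contra! hx
  have := IsSimpleModule.nontrivial R S
  obtain ⟨s, hs⟩ := exists_ne (0 : S)
  -- Each nonzero multiple of `x` has a further multiple equal to `i s`, so `i s` is reached with
  -- coefficients in every `m ^ n`. These differ by elements of `ann x`, which puts `r` in the
  -- closure of `ann x`.
  have key : ∀ n : ℕ, ∃ r ∈ m ^ n, r • x = i s := fun n ↦ by
    obtain ⟨a, ha, hax⟩ := hx n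
    obtain ⟨c, hc⟩ := h.exists_smul_eq hax s
    exact ⟨c * a, Ideal.mul_mem_left _ _ ha, by rw [mul_smul, hc]⟩
  obtain ⟨r, -, hr⟩ := key 0
  have hmem : r ∈ ⨅ n : ℕ, (Ideal.torsionOf R E x ⊔ m ^ n) := by
    refine Submodule.mem_iInf _ |>.2 fun n ↦ ?_
    obtain ⟨t, ht, htx⟩ := key n
    have h0 : r - t ∈ Ideal.torsionOf R E x := by
      rw [Ideal.mem_torsionOf_iff, sub_smul, hr, htx, sub_self]
    simpa using add_mem (Ideal.mem_sup_left h0) (Ideal.mem_sup_right ht)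
  rw [hm, Ideal.mem_torsionOf_iff, hr] at hmem
  exact hs (h.injective (by simpa using hmem))

/-- Induction on length by left exactness of `Hom(-, E)`. On a simple module, evaluation at a
generator embeds `Hom` into the simple submodule `range i`, since `range i` is essential. -/
theorem IsInjectiveHull.length_linearMap_le [IsSimpleModule R S] (h : IsInjectiveHull i)
    {X : Type u} [AddCommGroup X] [Module R X] (hX : IsFiniteLength R X) :
    Module.length R (X →ₗ[R] E) ≤ Module.length R X := by
  induction hX with
  | @of_subsingleton X _ _ _ =>
    have : Subsingleton (X →ₗ[R] E) := ⟨fun f g ↦ LinearMap.ext fun x ↦ by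
      rw [Subsingleton.elim x 0, map_zero, map_zero]⟩
    simp
  | @of_simple_quotient X _ _ N hN _ ih =>
    have := IsSimpleModule.nontrivial R S
    obtain ⟨s, hs⟩ := exists_ne (0 : S)
    have := IsSimpleModule.nontrivial R (X ⧸ N)
    obtain ⟨x, hx⟩ := exists_ne (0 : X ⧸ N)
    have hgen : ∀ y : X ⧸ N, ∃ c : R, c • x = y := fun y ↦ mem_span_singleton.1
      (by rw [IsSimpleModule.span_singleton_eq_top R hx]; trivial)
    let ev : ((X ⧸ N) →ₗ[R] E) →ₗ[R] E := LinearMap.applyₗ x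
    have hev : ∀ f, ev f ∈ LinearMap.range i := fun f ↦ by
      by_cases hf : f x = 0
      · exact hf ▸ zero_mem _
      obtain ⟨c, hc⟩ := h.exists_smul_eq hf s
      have hcx : c • x ≠ 0 := fun h0 ↦ hs (h.injective (by rw [← hc, ← map_smul, h0]; simp))
      obtain ⟨d, hd⟩ := mem_span_singleton.1 (show x ∈ R ∙ (c • x) by
        rw [IsSimpleModule.span_singleton_eq_top R hcx]; trivial)
      exact ⟨d • s, by rw [map_smul, ← hc, ← map_smul, ← map_smul, hd]; rfl⟩
    have hsimple : Module.length R ((X ⧸ N) →ₗ[R] E) ≤ 1 := by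
      have h1 := Module.length_le_of_injective (ev.codRestrict _ hev) fun f g hfg ↦
        LinearMap.ext fun y ↦ by
          obtain ⟨c, rfl⟩ := hgen y
          have : f x = g x := congrArg Subtype.val hfg
          rw [map_smul, map_smul, this]
      rwa [← (LinearEquiv.ofInjective i h.injective).length_eq, Module.length_eq_one R S] at h1
    let res : (X →ₗ[R] E) →ₗ[R] (N →ₗ[R] E) := LinearMap.lcomp R E N.subtype
    let p : ((X ⧸ N) →ₗ[R] E) →ₗ[R] (X →ₗ[R] E) := LinearMap.lcomp R E N.mkQ
    have hp : Function.Injective p := fun f g hfg ↦ by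
      ext y; exact LinearMap.congr_fun hfg y
    have hexact : Function.Exact p res.rangeRestrict := fun f ↦ by
      constructor
      · intro hf
        have hf' : ∀ y ∈ N, f y = 0 := fun y hy ↦
          LinearMap.congr_fun (congrArg Subtype.val hf) (⟨y, hy⟩ : N)
        exact ⟨N.liftQ f hf', by ext; rfl⟩
      · rintro ⟨g, rfl⟩
        refine Subtype.ext (LinearMap.ext fun y ↦ ?_)
        change g (N.mkQ y) = 0
        rw [mkQ_apply, (Submodule.Quotient.mk_eq_zero N).2 y.2, map_zero]
    rw [Module.length_eq_add_of_exact p res.rangeRestrict hp res.surjective_rangeRestrict hexact,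
      Module.length_eq_add_of_exact N.subtype N.mkQ N.injective_subtype N.mkQ_surjective
        (LinearMap.exact_subtype_mkQ N), Module.length_eq_one R (X ⧸ N), add_comm]
    exact add_le_add ((Module.length_le_of_injective _ (injective_subtype _)).trans ih) hsimple

theorem IsInjectiveHull.length_torsionBySet_le [IsSimpleModule R S] (h : IsInjectiveHull i)
    {J : Ideal R} (hJ : IsFiniteLength R (R ⧸ J)) :
    Module.length R (torsionBySet R E (J : Set R)) ≤ Module.length R (R ⧸ J) := by
  refine le_trans ?_ (h.length_linearMap_le hJ)
  let f : torsionBySet R E (J : Set R) →ₗ[R] ((R ⧸ J) →ₗ[R] E) :=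
    { toFun t := Submodule.liftQ J (LinearMap.toSpanSingleton R E t) fun a ha ↦
        (mem_torsionBySet_iff _ _).1 t.2 ⟨a, ha⟩
      map_add' t t' := Submodule.linearMap_qext _ (LinearMap.ext fun a ↦ smul_add a (t : E) t')
      map_smul' c t := Submodule.linearMap_qext _ (LinearMap.ext fun a ↦ smul_comm a c (t : E)) }
  refine Module.length_le_of_injective f fun t t' htt ↦ Subtype.ext ?_
  have := LinearMap.congr_fun htt (Submodule.Quotient.mk 1)
  change (1 : R) • (t : E) = (1 : R) • (t' : E) at this
  simpa using this

/-- A length count: `R ⧸ J` embeds in `Hom(N, E)`, so `ℓ(T) ≤ ℓ(R ⧸ J) ≤ ℓ(N) < ∞`, while `N ≤ T`.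
-/
theorem IsInjectiveHull.torsionBySet_annihilator [IsSimpleModule R S] (h : IsInjectiveHull i)
    (N : Submodule R E) (hN : IsFiniteLength R N) :
    torsionBySet R E (N.annihilator : Set R) = N := by
  let J := N.annihilator
  let T := torsionBySet R E (J : Set R)
  have hNT : N ≤ T := fun x hx ↦ (mem_torsionBySet_iff _ _).2 fun a ↦ mem_annihilator.1 a.2 x hx
  have h1 : Module.length R (R ⧸ J) ≤ Module.length R N := by
    refine le_trans ?_ (h.length_linearMap_le hN)
    let f : R →ₗ[R] (N →ₗ[R] E) := LinearMap.toSpanSingleton R _ N.subtype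
    have hf : LinearMap.ker f = J := by
      ext a
      simp only [LinearMap.mem_ker, J, mem_annihilator, f, LinearMap.toSpanSingleton_apply]
      exact ⟨fun h x hx ↦ LinearMap.congr_fun h (⟨x, hx⟩ : N),
        fun h ↦ LinearMap.ext fun x ↦ h x x.2⟩
    exact Module.length_le_of_injective (J.liftQ f hf.ge)
      (LinearMap.ker_eq_bot.1 (ker_liftQ_eq_bot _ _ _ hf.le))
  have hfin : Module.length R N ≠ ⊤ := Module.length_ne_top_iff.2 hN
  have h2 : Module.length R T ≤ Module.length R (R ⧸ J) :=
    h.length_torsionBySet_le (Module.length_ne_top_iff.1 (ne_top_of_le_ne_top hfin h1))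
  have hTN := h2.trans h1
  obtain ⟨_, _⟩ := isFiniteLength_iff_isNoetherian_isArtinian.1
    (Module.length_ne_top_iff.1 (ne_top_of_le_ne_top hfin hTN))
  refine le_antisymm ?_ hNT
  by_contra hle
  have hlt := Submodule.length_lt (R := R) (N := N.submoduleOf T)
    fun h ↦ hle (Submodule.submoduleOf_eq_top.1 h)
  rw [(Submodule.submoduleOfEquivOfLe hNT).length_eq] at hlt
  exact hlt.not_ge hTN

theorem Ideal.iInf_sup_pow_eq_of_isNoetherianRing [IsLocalRing R] [IsNoetherianRing R]
    (I : Ideal R) : ⨅ n : ℕ, (I ⊔ maximalIdeal R ^ n) = I := by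
  refine le_antisymm (fun x hx ↦ ?_) (le_iInf fun n ↦ le_sup_left)
  have h0 := Ideal.iInf_pow_smul_eq_bot_of_isLocalRing (M := R ⧸ I) (maximalIdeal R)
    (maximalIdeal.isMaximal R).ne_top
  rw [← Ideal.Quotient.eq_zero_iff_mem, ← Submodule.mem_bot (R := R), ← h0, Submodule.mem_iInf]
  intro n
  obtain ⟨y, hy, z, hz, rfl⟩ := Submodule.mem_sup.1 ((Submodule.mem_iInf _).1 hx n)
  have : Ideal.Quotient.mk I (y + z) = z • (1 : R ⧸ I) := by
    rw [map_add, Ideal.Quotient.eq_zero_iff_mem.2 hy, zero_add, Algebra.smul_def, mul_one]; rfl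
  rw [this]
  exact smul_mem_smul hz trivial

theorem IsLocalRing.isFiniteLength_quotient_pow [IsLocalRing R] [IsNoetherianRing R] (n : ℕ) :
    IsFiniteLength R (R ⧸ maximalIdeal R ^ n) := by
  let I := maximalIdeal R ^ n
  refine isFiniteLength_iff_isNoetherian_isArtinian.2 ⟨inferInstance, ?_⟩
  by_cases hI : I = ⊤
  · have : Subsingleton (R ⧸ I) := Ideal.Quotient.subsingleton_iff.2 hI
    exact inferInstanceAs (IsArtinian R (R ⧸ I))
  have : Nontrivial (R ⧸ I) := Ideal.Quotient.nontrivial_iff.2 hI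
  have := IsLocalRing.of_surjective' (Ideal.Quotient.mk I) Ideal.Quotient.mk_surjective
  have := IsLocalHom.of_surjective (Ideal.Quotient.mk I) Ideal.Quotient.mk_surjective
  have hmap : (maximalIdeal R).map (Ideal.Quotient.mk I) = maximalIdeal (R ⧸ I) := by
    ext x
    obtain ⟨x, rfl⟩ := Ideal.Quotient.mk_surjective x
    simp [sup_eq_left.mpr (le_maximalIdeal hI)]
  have : IsArtinianRing (R ⧸ I) := by
    refine (isArtinianRing_iff_isNilpotent_maximalIdeal _).2 ⟨n, ?_⟩
    rw [← hmap, ← Ideal.map_pow, Ideal.map_quotient_self, Ideal.zero_eq_bot]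
  exact isArtinian_of_surjective_algebraMap (R := R ⧸ I) (M := R ⧸ I)
    Ideal.Quotient.mk_surjective

theorem IsInjectiveHull.isArtinian [IsLocalRing R] [IsNoetherianRing R] [IsSimpleModule R S]
    (h : IsInjectiveHull i) : IsArtinian R E := by
  let m := maximalIdeal R
  let T (n : ℕ) := torsionBySet R E ((m ^ n : Ideal R) : Set R)
  have hT : ∀ n x, x ∈ T n ↔ ∀ a ∈ m ^ n, a • x = 0 := fun n x ↦ by
    simp [T, mem_torsionBySet_iff]
  have hTmono : Monotone T := fun a b hab ↦
    torsionBySet_le_torsionBySet_of_subset (Ideal.pow_le_pow_right hab)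
  have hTfin : ∀ n, IsFiniteLength R (T n) := fun n ↦ Module.length_ne_top_iff.1 <|
    ne_top_of_le_ne_top (Module.length_ne_top_iff.2 (isFiniteLength_quotient_pow n))
      (h.length_torsionBySet_le (isFiniteLength_quotient_pow n))
  let J (M : Submodule R E) (n : ℕ) : Ideal R := (M ⊓ T n).annihilator
  have hJT : ∀ M n, torsionBySet R E (J M n : Set R) = M ⊓ T n := fun M n ↦
    h.torsionBySet_annihilator _ ((hTfin n).of_injective (inclusion_injective inf_le_right))
  have hpow : ∀ M n, m ^ n ≤ J M n := fun M n a ha ↦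
    mem_annihilator.2 fun x hx ↦ (hT n x).1 hx.2 a ha
  have hanti : ∀ M, Antitone (J M) := fun M a b hab ↦
    annihilator_mono (inf_le_inf_left M (hTmono hab))
  -- Both sides annihilate the same part of `E`: `M ⊓ T (n + 1) ⊓ T n = M ⊓ T n`.
  have hsucc : ∀ M n, J M n ≤ J M (n + 1) ⊔ m ^ n := by
    intro M n
    rw [← h.annihilator_torsionBySet (J M (n + 1) ⊔ m ^ n)]
    refine annihilator_mono fun x hx ↦ ?_
    rw [mem_torsionBySet_iff] at hx
    have hx1 : x ∈ torsionBySet R E (J M (n + 1) : Set R) :=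
      (mem_torsionBySet_iff _ _).2 fun a ↦ hx ⟨a, Ideal.mem_sup_left a.2⟩
    rw [hJT] at hx1
    exact ⟨hx1.1, (hT n x).2 fun a ha ↦ hx ⟨a, Ideal.mem_sup_right ha⟩⟩
  have hmul : ∀ M k n, m ^ k * J M n ≤ J M (k + n) := by
    intro M k
    induction k with
    | zero => intro n; simp
    | succ k ih =>
      intro n
      rw [pow_succ, mul_assoc, add_right_comm, add_assoc]
      refine (Ideal.mul_mono_right ?_).trans (ih (n + 1))
      refine (Ideal.mul_mono_right (hsucc M n)).trans ?_
      rw [Ideal.mul_sup, ← pow_succ']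
      exact sup_le Ideal.mul_le_right (hpow M (n + 1))
  -- The shift to `n + 1` ensures that the family contains `m ^ (n + 1)`, because `M ⊓ T (n + 1)` is
  -- killed by that power.
  have hwf := wellFoundedGT_of_strictMono_family (m := m) (IsNoetherian.noetherian m)
    (α := (Submodule R E)ᵒᵈ) (fun M n ↦ J (OrderDual.ofDual M) (n + 1) ⊓ m ^ n) ?_
    (fun M n ↦ inf_le_right) (fun M n ↦ le_inf (hpow _ _) (Ideal.pow_le_pow_right n.le_succ))
    (fun M k n ↦ ?_)
  · exact (wellFoundedGT_dual_iff (Submodule R E)).1 hwf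
  · intro M M' hM
    refine lt_of_le_not_ge
      (fun n ↦ inf_le_inf_right _ (annihilator_mono (inf_le_inf_right _ hM.le))) fun hle ↦ ?_
    -- If the encodings agree, so do all the annihilators: by `hsucc`, an element of `J M' (n + 1)`
    -- is an element of `J M (n + 1)` plus an error in `J M' (n + 1) ⊓ m ^ n`, which `hle` absorbs.
    have hJ : ∀ n, J (OrderDual.ofDual M') n ≤ J (OrderDual.ofDual M) n := by
      intro n
      induction n with
      | zero => exact le_trans (by simp) (hpow _ 0)
      | succ n ih =>
        intro x hx
        obtain ⟨y, hy, z, hz, rfl⟩ := mem_sup.1 (hsucc _ n (ih (hanti _ n.le_succ hx)))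
        have hJJ : J (OrderDual.ofDual M) (n + 1) ≤ J (OrderDual.ofDual M') (n + 1) :=
          annihilator_mono (inf_le_inf_right _ hM.le)
        have hz' : z ∈ J (OrderDual.ofDual M') (n + 1) := by simpa using sub_mem hx (hJJ hy)
        exact add_mem hy (hle n ⟨hz', hz⟩).1
    refine hM.not_ge (OrderDual.toDual_le_toDual.1 fun x (hx : x ∈ OrderDual.ofDual M) ↦ ?_)
    obtain ⟨n, hn⟩ := h.exists_pow_smul_eq_zero (m := m)
      Ideal.iInf_sup_pow_eq_of_isNoetherianRing x
    have hx' : x ∈ torsionBySet R E (J (OrderDual.ofDual M) n : Set R) := by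
      rw [hJT]; exact ⟨hx, (hT n x).2 hn⟩
    have := torsionBySet_le_torsionBySet_of_subset (M := E) (hJ n) hx'
    rw [hJT] at this
    exact this.1
  · rw [add_assoc, pow_add]
    exact le_inf ((Ideal.mul_mono_right inf_le_left).trans (hmul _ k (n + 1)))
      (Ideal.mul_mono_right inf_le_right)

end Hull

/-! ### The implications between the four conditions -/

open IsLocalRing in
theorem SatisfiesDiamond.iInf_sup_pow {R : Type u} [CommRing R] [IsLocalRing R]
    (hR : SatisfiesDiamond R) (I : Ideal R) : ⨅ n : ℕ, (I ⊔ maximalIdeal R ^ n) = I := by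
  refine le_antisymm (fun x hx ↦ ?_) (le_iInf fun n ↦ le_sup_left)
  by_contra hxI
  have hS : IsSimpleModule R (R ⧸ maximalIdeal R) :=
    isSimpleModule_iff_quot_maximal.2 ⟨_, maximalIdeal.isMaximal R, ⟨.refl R _⟩⟩
  obtain ⟨E, _, _, i, h⟩ := exists_isInjectiveHull (R := R) (R ⧸ maximalIdeal R)
  obtain ⟨y, hy, hxy⟩ := h.exists_smul_ne_zero hxI
  have := hR _ E i hS h (Submodule.span R {y}) (Submodule.fg_span_singleton y)
  have : IsArtinian R (R ⧸ Ideal.torsionOf R E y) :=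
    isArtinian_of_linearEquiv (Ideal.quotTorsionOfEquivSpanSingleton R E y).symm
  have : IsArtinianRing (R ⧸ Ideal.torsionOf R E y) := isArtinian_of_tower R this
  obtain ⟨n, hn⟩ := exists_maximalIdeal_pow_le_of_isArtinianRing_quotient (Ideal.torsionOf R E y)
  have hle : I ⊔ maximalIdeal R ^ n ≤ Ideal.torsionOf R E y :=
    sup_le (fun a ha ↦ (Ideal.mem_torsionOf_iff _ _).2 (hy a ha)) hn
  exact hxy ((Ideal.mem_torsionOf_iff _ _).1 (hle ((Submodule.mem_iInf _).1 hx n)))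

open IsLocalRing in
theorem IsCoNoetherianRing.isNoetherianRing {R : Type u} [CommRing R] [IsLocalRing R]
    (hR : IsCoNoetherianRing R) : IsNoetherianRing R := by
  have hS : IsSimpleModule R (R ⧸ maximalIdeal R) :=
    isSimpleModule_iff_quot_maximal.2 ⟨_, maximalIdeal.isMaximal R, ⟨.refl R _⟩⟩
  obtain ⟨E, _, _, i, h⟩ := exists_isInjectiveHull (R := R) (R ⧸ maximalIdeal R)
  have := hR _ E i hS h
  exact h.isNoetherianRing

theorem lemma3p1 {R : Type u} [CommRing R] [IsLocalRing R] :
    List.TFAE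
      [IsNoetherianRing R,
       IsCoNoetherianRing R,
       SatisfiesDiamond R ∧
         Module.Finite R (IsLocalRing.maximalIdeal R).Cotangent,
       (∀ I : Ideal R, (⨅ n : ℕ, (I ⊔ IsLocalRing.maximalIdeal R ^ n)) = I) ∧
         Module.Finite R (IsLocalRing.maximalIdeal R).Cotangent] := by
  tfae_have 1 → 2 := fun _ S E _ _ _ _ i _ h ↦ h.isArtinian
  tfae_have 2 → 3 := fun h ↦
    have := h.isNoetherianRing
    ⟨fun S E _ _ _ _ i hS hi N _ ↦ have := h S E i hS hi; inferInstance,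
      Module.Finite.of_surjective _ (Ideal.toCotangent_surjective _)⟩
  tfae_have 3 → 4 := fun h ↦ ⟨h.1.iInf_sup_pow, h.2⟩
  tfae_have 4 → 1 := fun ⟨h, _⟩ ↦
    isNoetherianRing_of_iInf_sup_pow (Ideal.fg_of_finite_cotangent h) h
  tfae_finish
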